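/- Conventions. All Banach lattices are complex: a complex Banach lattice is the complexification $E_{\mathbb C}=E\oplus iE$ of a real Banach lattice $E$, with modulus $|x+iy|=\sup_{\theta\in\mathbb R}(\cos\theta\,x+\sin\theta\,y)$ and norm $\|z\|=\||z|\|$; as usual we write $E$ for $E_{\mathbb C}$ as well, and $E$ is called its real part. It is atomic if every $x>0$ in the real part dominates an atom, that is, some $a>0$ such that every $y$ with $0\le y\le a$ is a scalar multiple of $a$; its norm is order continuous if every net in the real part that decreases to $0$ converges to $0$ in norm. Operators are bounded and linear over $\mathbb C$. An operator $T$ is positive if $Tx\ge 0$ whenever $x\ge 0$, and $T$ dominates $S$ if $|Sx|\le T|x|$ for every $x$. The essential spectrum $\sigma_{\rm ess}(T)$ and essential spectral radius $r_{\rm ess}(T)$ of an operator $T$ on $E$ are the spectrum and the spectral radius of the image of $T$ in the Calkin algebra $\mathcal L(E)/\mathcal K(E)$ (bounded operators modulo compact operators; the spectral radius is $\sup\{|\lambda|:\lambda\in\sigma_{\rm ess}(T)\}$, which is $0$ if $\sigma_{\rm ess}(T)=\emptyset$). For a bounded set $A$, $\chi(A)$ is the infimum of all $\delta>0$ such that $A$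 can be covered by finitely many balls of radius $\delta$, and $\chi(T)=\chi(TB_E)$ for $T\colon E\to F$, where $B_E$ is the unit ball of $E$. Theorem. Let $E$ and $F$ be atomic Banach lattices with order continuous norms. 1. If $E$ is infinite-dimensional and $T$ is a positive operator on $E$, then $r_{\rm ess}(T)\in\sigma_{\rm ess}(T)$. 2. If $S,T\colon E\to E$ and $T$ dominates $S$, then $r_{\rm ess}(S)\le r_{\rm ess}(T)$. 3. If $S,T\colon E\to F$ and $T$ dominates $S$, then $\chi(S)\le\chi(T)$. (In part 3 the dual $E'$ is not assumed to have order continuous norm.) -/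

import Mathlib

open scoped ENNReal

set_option linter.unusedSectionVars false

/-! ### Complex Banach lattices

A complex Banach lattice is the complexification `E ⊕ iE` of a real Banach lattice `E`, with
modulus `|x + iy| = sup_θ (cos θ • x + sin θ • y)` and norm `‖z‖ = ‖|z|‖`. -/

/-- The underlying set of the complexification `E ⊕ iE` of `E`. -/
@[ext]
structure LatticeComplexification (E : Type*) where
  re : E
  im : E

namespace LatticeComplexification

section Algebra

variable {E : Type*} [AddCommGroup E]

instance : Zero (LatticeComplexification E) := ⟨⟨0, 0⟩⟩
instance : Add (LatticeComplexification E) := ⟨fun z w => ⟨z.re + w.re, z.im + w.im⟩⟩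
instance : Neg (LatticeComplexification E) := ⟨fun z => ⟨-z.re, -z.im⟩⟩

@[simp] theorem zero_re : (0 : LatticeComplexification E).re = 0 := rfl
@[simp] theorem zero_im : (0 : LatticeComplexification E).im = 0 := rfl
@[simp] theorem add_re (z w : LatticeComplexification E) : (z + w).re = z.re + w.re := rfl
@[simp] theorem add_im (z w : LatticeComplexification E) : (z + w).im = z.im + w.im := rfl
@[simp] theorem neg_re (z : LatticeComplexification E) : (-z).re = -z.re := rfl
@[simp] theorem neg_im (z : LatticeComplexification E) : (-z).im = -z.im := rfl

instance : AddCommGroup (LatticeComplexification E) where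
  add_assoc a b c := by ext <;> simp [add_assoc]
  zero_add a := by ext <;> simp
  add_zero a := by ext <;> simp
  nsmul := nsmulRec
  zsmul := zsmulRec
  neg_add_cancel a := by ext <;> simp
  add_comm a b := by ext <;> simp [add_comm]

@[simp] theorem sub_re (z w : LatticeComplexification E) : (z - w).re = z.re - w.re := by
  simp [sub_eq_add_neg]
@[simp] theorem sub_im (z w : LatticeComplexification E) : (z - w).im = z.im - w.im := by
  simp [sub_eq_add_neg]

variable [Module ℝ E]

/-- `(a + ib)(x + iy) = (a x - b y) + i (a y + b x)`. -/
instance : SMul ℂ (LatticeComplexification E) :=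
  ⟨fun c z => ⟨c.re • z.re - c.im • z.im, c.re • z.im + c.im • z.re⟩⟩

@[simp] theorem smul_re (c : ℂ) (z : LatticeComplexification E) :
    (c • z).re = c.re • z.re - c.im • z.im := rfl
@[simp] theorem smul_im (c : ℂ) (z : LatticeComplexification E) :
    (c • z).im = c.re • z.im + c.im • z.re := rfl

instance : Module ℂ (LatticeComplexification E) where
  one_smul z := by ext <;> simp
  mul_smul a b z := by ext <;> simp <;> module
  smul_zero a := by ext <;> simp
  smul_add a z w := by ext <;> simp <;> module
  add_smul a b z := by ext <;> simp <;> module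
  zero_smul z := by ext <;> simp

/-- The inclusion of `E` as the real part of its complexification. -/
def ofReal (x : E) : LatticeComplexification E := ⟨x, 0⟩

/-- The order of a complex Banach lattice: `z ≤ w` iff `w - z` lies in the positive cone of the
real part. -/
instance [PartialOrder E] : PartialOrder (LatticeComplexification E) where
  le z w := z.re ≤ w.re ∧ z.im = w.im
  le_refl z := ⟨le_rfl, rfl⟩
  le_trans a b c h k := ⟨h.1.trans k.1, h.2.trans k.2⟩
  le_antisymm a b h k := LatticeComplexification.ext (h.1.antisymm k.1) h.2

theorem le_def [PartialOrder E] {z w : LatticeComplexification E} :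
    z ≤ w ↔ z.re ≤ w.re ∧ z.im = w.im := Iff.rfl

end Algebra

section Modulus

variable {E : Type*} [NormedAddCommGroup E] [Lattice E] [HasSolidNorm E] [IsOrderedAddMonoid E]
  [NormedSpace ℝ E] [IsOrderedModule ℝ E]

/-- The rotated real parts `cos θ • x + sin θ • y` of `z = x + iy`. -/
noncomputable def rot (z : LatticeComplexification E) (θ : ℝ) : E :=
  Real.cos θ • z.re + Real.sin θ • z.im

theorem smul_le_of_abs_le {a r : ℝ} (h : |a| ≤ r) (x : E) : a • x ≤ r • |x| := by
  have h1 : a • x ≤ |a| • |x| := by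
    rcases le_total 0 a with ha | ha
    · rw [abs_of_nonneg ha]
      exact smul_le_smul_of_nonneg_left (le_abs_self x) ha
    · rw [abs_of_nonpos ha, ← neg_smul_neg a x]
      exact smul_le_smul_of_nonneg_left (neg_le_abs x) (neg_nonneg.2 ha)
  exact h1.trans (smul_le_smul_of_nonneg_right h (abs_nonneg x))

theorem rot_le_rot_add (z : LatticeComplexification E) {θ φ r : ℝ} (h : |θ - φ| ≤ r) :
    rot z θ ≤ rot z φ + r • (|z.re| + |z.im|) := by
  have h1 := smul_le_of_abs_le ((Real.abs_cos_sub_cos_le θ φ).trans h) z.re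
  have h2 := smul_le_of_abs_le ((Real.abs_sin_sub_sin_le θ φ).trans h) z.im
  have h3 : rot z θ = rot z φ
      + ((Real.cos θ - Real.cos φ) • z.re + (Real.sin θ - Real.sin φ) • z.im) := by
    simp only [rot]; module
  rw [h3, smul_add]
  gcongr

/-- The maximum of the rotated real parts over the `(n + 1)`-st roots of unity. -/
noncomputable def gridSup (z : LatticeComplexification E) (n : ℕ) : E :=
  (Finset.range (n + 1)).sup' Finset.nonempty_range_add_one
    (fun k => rot z (2 * Real.pi * k / (n + 1)))

theorem rot_le_gridSup (z : LatticeComplexification E) (n : ℕ) (θ : ℝ) :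
    rot z θ ≤ gridSup z n + (2 * Real.pi / (n + 1)) • (|z.re| + |z.im|) := by
  have hn : (0 : ℝ) < n + 1 := by positivity
  have hpi := Real.two_pi_pos
  set t : ℝ := θ / (2 * Real.pi) with ht
  set k : ℕ := ⌊Int.fract t * (n + 1)⌋₊ with hk
  have hnn : 0 ≤ Int.fract t * (n + 1) := mul_nonneg (Int.fract_nonneg t) hn.le
  have hk1 : (k : ℝ) ≤ Int.fract t * (n + 1) := Nat.floor_le hnn
  have hk2 : Int.fract t * (n + 1) < k + 1 := Nat.lt_floor_add_one _
  have hkn : k ∈ Finset.range (n + 1) := by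
    have : (k : ℝ) < ((n + 1 : ℕ) : ℝ) := by
      push_cast
      nlinarith [Int.fract_lt_one t]
    exact Finset.mem_range.2 (by exact_mod_cast this)
  have hrot : rot z θ = rot z (2 * Real.pi * Int.fract t) := by
    have : 2 * Real.pi * Int.fract t = θ - ⌊t⌋ * (2 * Real.pi) := by
      rw [Int.fract, ht]
      field_simp
    simp only [rot, this, Real.cos_sub_int_mul_two_pi, Real.sin_sub_int_mul_two_pi]
  have hdist : |2 * Real.pi * Int.fract t - 2 * Real.pi * k / (n + 1)|
      ≤ 2 * Real.pi / (n + 1) := by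
    have : 2 * Real.pi * Int.fract t - 2 * Real.pi * k / (n + 1)
        = 2 * Real.pi / (n + 1) * (Int.fract t * (n + 1) - k) := by
      field_simp
    rw [this, abs_of_nonneg (mul_nonneg (by positivity) (by linarith))]
    exact mul_le_of_le_one_right (by positivity) (by linarith)
  rw [hrot]
  refine (rot_le_rot_add z hdist).trans ?_
  gcongr
  exact Finset.le_sup' (fun k : ℕ => rot z (2 * Real.pi * k / (n + 1))) hkn

theorem gridSup_le (z : LatticeComplexification E) (n : ℕ) {b : E} (hb : ∀ θ, rot z θ ≤ b) :
    gridSup z n ≤ b :=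
  Finset.sup'_le _ _ fun _ _ => hb _

theorem tendsto_mesh (u : E) :
    Filter.Tendsto (fun n : ℕ => (2 * Real.pi / ((n : ℝ) + 1)) • u) Filter.atTop (nhds 0) := by
  have h : Filter.Tendsto (fun n : ℕ => 2 * Real.pi * (1 / ((n : ℝ) + 1))) Filter.atTop
      (nhds (2 * Real.pi * 0)) := tendsto_one_div_add_atTop_nhds_zero_nat.const_mul _
  have := h.smul_const u
  simpa [div_eq_mul_inv] using this

variable [CompleteSpace E]

/-- The supremum defining the modulus exists in every real Banach lattice. -/
theorem exists_isLUB_rot (z : LatticeComplexification E) :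
    ∃ m : E, IsLUB (Set.range (rot z)) m := by
  set u := |z.re| + |z.im| with hu
  have hu0 : 0 ≤ u := add_nonneg (abs_nonneg _) (abs_nonneg _)
  have key : ∀ m n, gridSup z m - gridSup z n ≤ (2 * Real.pi / ((n : ℝ) + 1)) • u := fun m n => by
    rw [sub_le_iff_le_add']
    exact gridSup_le z m fun θ => rot_le_gridSup z n θ
  have hcau : CauchySeq (gridSup z) := by
    refine cauchySeq_of_le_tendsto_0 (fun n : ℕ => ‖(2 * Real.pi / ((n : ℝ) + 1)) • u‖) ?_ ?_
    · intro n m N hn hm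
      rw [dist_eq_norm]
      apply norm_le_norm_of_abs_le_abs
      have mono : ∀ k : ℕ, N ≤ k → (2 * Real.pi / ((k : ℝ) + 1)) • u
          ≤ (2 * Real.pi / ((N : ℝ) + 1)) • u := fun k hk => by
        have : (N : ℝ) ≤ k := by exact_mod_cast hk
        exact smul_le_smul_of_nonneg_right (by gcongr) hu0
      refine le_trans ?_ (le_abs_self _)
      rw [abs_le']
      refine ⟨(key n m).trans (mono m hm), ?_⟩
      rw [neg_sub]
      exact (key m n).trans (mono n hn)
    · simpa using (tendsto_mesh u).norm
  obtain ⟨m, hm⟩ := cauchySeq_tendsto_of_complete hcau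
  refine ⟨m, ?_, ?_⟩
  · rintro _ ⟨θ, rfl⟩
    have := hm.add (tendsto_mesh u)
    rw [add_zero] at this
    exact ge_of_tendsto' this fun n => rot_le_gridSup z n θ
  · intro b hb
    exact le_of_tendsto' hm fun n => gridSup_le z n fun θ => hb ⟨θ, rfl⟩

/-- The modulus `|x + iy| = sup_θ (cos θ • x + sin θ • y)`. -/
noncomputable def modulus (z : LatticeComplexification E) : E :=
  Classical.choose (exists_isLUB_rot z)

theorem isLUB_modulus (z : LatticeComplexification E) : IsLUB (Set.range (rot z)) (modulus z) :=
  Classical.choose_spec (exists_isLUB_rot z)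

theorem rot_le_modulus (z : LatticeComplexification E) (θ : ℝ) : rot z θ ≤ modulus z :=
  (isLUB_modulus z).1 ⟨θ, rfl⟩

theorem modulus_le {z : LatticeComplexification E} {b : E} (h : ∀ θ, rot z θ ≤ b) :
    modulus z ≤ b :=
  (isLUB_modulus z).2 (by rintro _ ⟨θ, rfl⟩; exact h θ)

theorem abs_re_le_modulus (z : LatticeComplexification E) : |z.re| ≤ modulus z := by
  have h0 := rot_le_modulus z 0
  have h1 := rot_le_modulus z Real.pi
  simp only [rot, Real.cos_zero, Real.sin_zero, Real.cos_pi, Real.sin_pi, one_smul, zero_smul,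
    add_zero, neg_smul] at h0 h1
  exact abs_le'.2 ⟨h0, h1⟩

theorem abs_im_le_modulus (z : LatticeComplexification E) : |z.im| ≤ modulus z := by
  have h0 := rot_le_modulus z (Real.pi / 2)
  have h1 := rot_le_modulus z (-(Real.pi / 2))
  simp only [rot, Real.cos_pi_div_two, Real.sin_pi_div_two, Real.cos_neg, Real.sin_neg, one_smul,
    zero_smul, zero_add, neg_smul] at h0 h1
  exact abs_le'.2 ⟨h0, h1⟩

theorem modulus_nonneg (z : LatticeComplexification E) : 0 ≤ modulus z :=
  (abs_nonneg _).trans (abs_re_le_modulus z)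

theorem modulus_le_abs_add_abs (z : LatticeComplexification E) :
    modulus z ≤ |z.re| + |z.im| :=
  modulus_le fun θ => by
    have h1 := smul_le_of_abs_le (Real.abs_cos_le_one θ) z.re
    have h2 := smul_le_of_abs_le (Real.abs_sin_le_one θ) z.im
    rw [one_smul] at h1 h2
    exact add_le_add h1 h2

theorem modulus_ofReal (x : E) : modulus (ofReal x) = |x| := by
  refine le_antisymm ?_ (abs_re_le_modulus (ofReal x))
  simpa [ofReal] using modulus_le_abs_add_abs (ofReal x)

theorem modulus_add_le (z w : LatticeComplexification E) :
    modulus (z + w) ≤ modulus z + modulus w :=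
  modulus_le fun θ => by
    have : rot (z + w) θ = rot z θ + rot w θ := by simp only [rot, add_re, add_im]; module
    rw [this]
    exact add_le_add (rot_le_modulus z θ) (rot_le_modulus w θ)

theorem rot_smul (c : ℂ) (z : LatticeComplexification E) (θ : ℝ) :
    rot (c • z) θ = ‖c‖ • rot z (θ - c.arg) := by
  have hre : c.re = ‖c‖ * Real.cos c.arg := (Complex.norm_mul_cos_arg c).symm
  have him : c.im = ‖c‖ * Real.sin c.arg := (Complex.norm_mul_sin_arg c).symm
  simp only [rot, smul_re, smul_im, Real.cos_sub, Real.sin_sub]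
  rw [hre, him]
  module

theorem modulus_smul (c : ℂ) (z : LatticeComplexification E) :
    modulus (c • z) = ‖c‖ • modulus z := by
  have le : ∀ (c : ℂ) (z : LatticeComplexification E), modulus (c • z) ≤ ‖c‖ • modulus z :=
    fun c z => modulus_le fun θ => by
      rw [rot_smul]
      exact smul_le_smul_of_nonneg_left (rot_le_modulus z _) (norm_nonneg c)
  refine le_antisymm (le c z) ?_
  rcases eq_or_ne c 0 with rfl | hc
  · simpa using modulus_nonneg ((0 : ℂ) • z)
  · have hc' : ‖c‖ ≠ 0 := norm_ne_zero_iff.2 hc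
    have h := le c⁻¹ (c • z)
    rw [smul_smul, inv_mul_cancel₀ hc, one_smul, norm_inv] at h
    have h2 := smul_le_smul_of_nonneg_left h (norm_nonneg c)
    rwa [smul_smul, mul_inv_cancel₀ hc', one_smul] at h2

/-- The norm of a complex Banach lattice: `‖z‖ = ‖|z|‖`. -/
noncomputable instance : Norm (LatticeComplexification E) := ⟨fun z => ‖modulus z‖⟩

theorem norm_def (z : LatticeComplexification E) : ‖z‖ = ‖modulus z‖ := rfl

theorem norm_re_le (z : LatticeComplexification E) : ‖z.re‖ ≤ ‖z‖ :=
  norm_le_norm_of_abs_le_abs ((abs_re_le_modulus z).trans (le_abs_self _))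

theorem norm_im_le (z : LatticeComplexification E) : ‖z.im‖ ≤ ‖z‖ :=
  norm_le_norm_of_abs_le_abs ((abs_im_le_modulus z).trans (le_abs_self _))

theorem norm_le_re_add_im (z : LatticeComplexification E) : ‖z‖ ≤ ‖z.re‖ + ‖z.im‖ := by
  have h : ‖modulus z‖ ≤ ‖|z.re| + |z.im|‖ := norm_le_norm_of_abs_le_abs (by
    rw [abs_of_nonneg (modulus_nonneg z)]
    exact (modulus_le_abs_add_abs z).trans (le_abs_self _))
  refine h.trans ((norm_add_le _ _).trans ?_)
  rw [norm_abs_eq_norm, norm_abs_eq_norm]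

theorem normedSpaceCore : NormedSpace.Core ℂ (LatticeComplexification E) where
  norm_nonneg z := norm_nonneg (modulus z)
  norm_smul c z := by
    rw [norm_def, norm_def, modulus_smul, norm_smul, norm_norm]
  norm_triangle z w := by
    refine le_trans ?_ (norm_add_le (modulus z) (modulus w))
    apply norm_le_norm_of_abs_le_abs
    rw [abs_of_nonneg (modulus_nonneg _)]
    exact (modulus_add_le z w).trans (le_abs_self _)
  norm_eq_zero_iff z := by
    constructor
    · intro h
      have h1 := norm_re_le z
      have h2 := norm_im_le z
      rw [h] at h1 h2
      exact LatticeComplexification.ext (norm_le_zero_iff.1 h1) (norm_le_zero_iff.1 h2)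
    · rintro rfl
      refine le_antisymm ?_ (norm_nonneg (modulus (0 : LatticeComplexification E)))
      simpa using norm_le_re_add_im (0 : LatticeComplexification E)

noncomputable instance : NormedAddCommGroup (LatticeComplexification E) :=
  NormedAddCommGroup.ofCore (𝕜 := ℂ) normedSpaceCore

noncomputable instance : NormedSpace ℂ (LatticeComplexification E) :=
  NormedSpace.ofCore normedSpaceCore

theorem dist_re_le (z w : LatticeComplexification E) : dist z.re w.re ≤ dist z w := by
  have h := norm_re_le (z - w)
  rw [sub_re] at h
  rw [dist_eq_norm, dist_eq_norm]
  exact h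

theorem dist_im_le (z w : LatticeComplexification E) : dist z.im w.im ≤ dist z w := by
  have h := norm_im_le (z - w)
  rw [sub_im] at h
  rw [dist_eq_norm, dist_eq_norm]
  exact h

theorem dist_le_re_add_im (z w : LatticeComplexification E) :
    dist z w ≤ dist z.re w.re + dist z.im w.im := by
  have h := norm_le_re_add_im (z - w)
  rw [sub_re, sub_im] at h
  rw [dist_eq_norm, dist_eq_norm, dist_eq_norm]
  exact h

instance : CompleteSpace (LatticeComplexification E) := by
  refine Metric.complete_of_cauchySeq_tendsto fun u hu => ?_
  have hu' := Metric.cauchySeq_iff.1 hu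
  have hre : CauchySeq fun n => (u n).re := Metric.cauchySeq_iff.2 fun ε hε => by
    obtain ⟨N, hN⟩ := hu' ε hε
    exact ⟨N, fun m hm n hn => (dist_re_le (u m) (u n)).trans_lt (hN m hm n hn)⟩
  have him : CauchySeq fun n => (u n).im := Metric.cauchySeq_iff.2 fun ε hε => by
    obtain ⟨N, hN⟩ := hu' ε hε
    exact ⟨N, fun m hm n hn => (dist_im_le (u m) (u n)).trans_lt (hN m hm n hn)⟩
  obtain ⟨x, hx⟩ := cauchySeq_tendsto_of_complete hre
  obtain ⟨y, hy⟩ := cauchySeq_tendsto_of_complete him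
  refine ⟨⟨x, y⟩, ?_⟩
  have hx' := tendsto_iff_dist_tendsto_zero.1 hx
  have hy' := tendsto_iff_dist_tendsto_zero.1 hy
  have hxy := hx'.add hy'
  rw [add_zero] at hxy
  exact tendsto_iff_dist_tendsto_zero.2 (squeeze_zero (fun n => dist_nonneg)
    (fun n => dist_le_re_add_im (u n) ⟨x, y⟩) hxy)

end Modulus

end LatticeComplexification

/-! ### Atomic Banach lattices and order continuous norms -/

/-- An atom of a real Banach lattice: a vector `a > 0` such that every `x` with `0 ≤ x ≤ a` is a
scalar multiple of `a`. -/
def IsLatticeAtom {E : Type*} [NormedAddCommGroup E] [Lattice E] [NormedSpace ℝ E] (a : E) :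
    Prop :=
  0 < a ∧ ∀ x : E, 0 ≤ x → x ≤ a → ∃ c : ℝ, x = c • a

/-- `E` is atomic: every vector `x > 0` dominates an atom. -/
def IsAtomicBanachLattice (E : Type*) [NormedAddCommGroup E] [Lattice E] [NormedSpace ℝ E] :
    Prop :=
  ∀ x : E, 0 < x → ∃ a : E, IsLatticeAtom a ∧ a ≤ x

/-- `E` has order continuous norm: every net that decreases to `0` converges to `0` in norm.
Decreasing nets are given by their ranges, which are downward directed sets. -/
def HasOrderContinuousNorm (E : Type*) [NormedAddCommGroup E] [Lattice E] : Prop :=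
  ∀ D : Set E, D.Nonempty → DirectedOn (fun x y => y ≤ x) D → IsGLB D 0 →
    ∀ ε : ℝ, 0 < ε → ∃ x ∈ D, ∀ y ∈ D, y ≤ x → ‖y‖ < ε

/-! ### Positive operators and domination -/

section Operators

variable {E F : Type*}
  [NormedAddCommGroup E] [Lattice E] [HasSolidNorm E] [IsOrderedAddMonoid E]
  [NormedSpace ℝ E] [IsOrderedModule ℝ E] [CompleteSpace E]
  [NormedAddCommGroup F] [Lattice F] [HasSolidNorm F] [IsOrderedAddMonoid F]
  [NormedSpace ℝ F] [IsOrderedModule ℝ F] [CompleteSpace F]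

/-- `T` is positive: it maps positive vectors to positive vectors. -/
def IsPositiveOperator (T : LatticeComplexification E →L[ℂ] LatticeComplexification F) : Prop :=
  ∀ z, 0 ≤ z → 0 ≤ T z

/-- `T` dominates `S`: `|S z| ≤ T |z|` for every `z`. -/
def OperatorDominates (T S : LatticeComplexification E →L[ℂ] LatticeComplexification F) : Prop :=
  ∀ z, LatticeComplexification.ofReal (S z).modulus
    ≤ T (LatticeComplexification.ofReal z.modulus)

end Operators

/-! ### Measure of noncompactness -/

/-- The Hausdorff (ball) measure of noncompactness of a bounded set `A`. -/
noncomputable def hausdorffNoncompactness {X : Type*} [PseudoMetricSpace X] (A : Set X) : ℝ :=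
  sInf {δ : ℝ | 0 < δ ∧ ∃ C : Set X, C.Finite ∧ A ⊆ ⋃ c ∈ C, Metric.closedBall c δ}

/-- The measure of noncompactness `χ(T) = χ(T B_X)` of an operator. -/
noncomputable def operatorNoncompactness {X Y : Type*} [NormedAddCommGroup X] [NormedSpace ℂ X]
    [NormedAddCommGroup Y] [NormedSpace ℂ Y] (T : X →L[ℂ] Y) : ℝ :=
  hausdorffNoncompactness (T '' Metric.closedBall 0 1)

/-! ### Calkin algebra and essential spectrum -/

section Calkin

variable (X : Type*) [NormedAddCommGroup X] [NormedSpace ℂ X]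

/-- The ideal of compact operators in the algebra of bounded operators on `X`. -/
def compactIdeal : Ideal (X →L[ℂ] X) where
  carrier := {K | IsCompactOperator K}
  add_mem' hf hg := hf.add hg
  zero_mem' := isCompactOperator_zero
  smul_mem' T _ hK := hK.clm_comp T

instance : (compactIdeal X).IsTwoSided where
  mul_mem_of_left T hK := hK.comp_clm T

/-- The Calkin algebra of `X`. -/
abbrev CalkinAlgebra : Type _ := (X →L[ℂ] X) ⧸ compactIdeal X

variable {X}

/-- The essential spectrum of `T`: the spectrum of its image in the Calkin algebra. -/
def essentialSpectrum (T : X →L[ℂ] X) : Set ℂ :=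
  spectrum ℂ (Ideal.Quotient.mk (compactIdeal X) T : CalkinAlgebra X)

/-- The essential spectral radius of `T`: the spectral radius of its image in the Calkin
algebra. -/
noncomputable def essentialSpectralRadius (T : X →L[ℂ] X) : ℝ≥0∞ :=
  spectralRadius ℂ (Ideal.Quotient.mk (compactIdeal X) T : CalkinAlgebra X)

/-- On a Banach space the essential spectral radius is finite. -/
theorem essentialSpectralRadius_ne_top [CompleteSpace X] (T : X →L[ℂ] X) :
    essentialSpectralRadius T ≠ ⊤ := by
  have hsub : essentialSpectrum T ⊆ spectrum ℂ T :=
    AlgHom.spectrum_apply_subset (Ideal.Quotient.mkₐ ℂ (compactIdeal X)) T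
  refine ne_top_of_le_ne_top
    (b := ((‖T‖₊ * ‖(1 : X →L[ℂ] X)‖₊ : NNReal) : ℝ≥0∞)) ENNReal.coe_ne_top ?_
  refine iSup₂_le fun k hk => ?_
  exact_mod_cast spectrum.norm_le_norm_mul_of_mem (hsub hk)

end Calkin

/-! Everything rests on tail operators: operators `Q` with `0 ≤ Q ≤ 1` and `1 - Q` compact, such as
`x ↦ x - φ(x) a`, which removes the coordinate of an atom `a`, and products of these. For `x ≥ 0`
the tails `Q x` are directed downwards. A lower bound that is not `≤ 0` would have a positive part
dominating an atom, which some `Q` removes, so the infimum is `0` and order continuity makes the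
tails small in norm.

If finitely many balls of radius `δ` cover the image of the unit ball under `T`, a tail operator
that is small on the centres gives `‖Q T‖ ≤ δ + ε`. Conversely `T - Q T` is compact, so `‖Q T‖`
bounds both `χ(T)` and the essential norm of `T`. Both quantities therefore equal the infimum of `‖Q
T‖` over all `Q`. If `T` dominates `S`, then `Q T` dominates `Q S`, hence `‖Q S‖ ≤ ‖Q T‖`, and both
are monotone under domination. Since `Q` acts on the range side, nothing is needed about `E'`.

Part 2 follows by Gelfand's formula in the Calkin algebra, because `T ^ n` dominates `S ^ n`. For
part 1, `∑ (|z| T) ^ i` dominates `∑ (z T) ^ i`, so inside the disc of convergence the resolvent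
series in the Calkin algebra is bounded in norm by its value at `|z|`. A spectral point of maximal
modulus makes the resolvent blow up along its ray, hence also along the positive ray, as in
Pringsheim's theorem. -/

/-! ### Atoms and their coordinate functionals. -/

section RealLattice

variable {E : Type*} [NormedAddCommGroup E] [Lattice E] [HasSolidNorm E] [IsOrderedAddMonoid E]
  [NormedSpace ℝ E] [IsOrderedModule ℝ E]

theorem abs_smul_eq_abs_smul_abs (c : ℝ) (x : E) : |c • x| = |c| • |x| := by
  have key : ∀ (c : ℝ) (x : E), |c • x| ≤ |c| • |x| := fun c x => by
    refine abs_le'.2 ⟨LatticeComplexification.smul_le_of_abs_le le_rfl x, ?_⟩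
    rw [← neg_smul]
    exact LatticeComplexification.smul_le_of_abs_le (abs_neg c).le x
  refine le_antisymm (key c x) ?_
  rcases eq_or_ne c 0 with rfl | hc
  · simp
  · have h := smul_le_smul_of_nonneg_left (key c⁻¹ (c • x)) (abs_nonneg c)
    rwa [smul_smul, inv_mul_cancel₀ hc, one_smul, smul_smul, abs_inv,
      mul_inv_cancel₀ (abs_ne_zero.2 hc), one_smul] at h

/-- The disjoint complement `{x | |x| ⊓ a = 0}` of a positive vector. -/
def disjointComplement {a : E} (ha : 0 ≤ a) : Submodule ℝ E where
  carrier := {x | |x| ⊓ a ≤ 0}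
  zero_mem' := by simp
  add_mem' {x y} hx hy := by
    have h1 : |x + y| ⊓ a ≤ |x| + |y| := inf_le_left.trans (abs_add_le x y)
    have h2 : |x + y| ⊓ a - |y| ≤ |x| ⊓ a :=
      le_inf (sub_le_iff_le_add.2 h1) ((sub_le_self _ (abs_nonneg y)).trans inf_le_right)
    have h3 : |x + y| ⊓ a ≤ |y| := sub_nonpos.1 (h2.trans hx)
    exact (le_inf h3 inf_le_right).trans hy
  smul_mem' c x hx := by
    change |c • x| ⊓ a ≤ 0
    rw [abs_smul_eq_abs_smul_abs]
    -- With this `d`, both `d⁻¹ * |c| ≤ 1` and `d⁻¹ ≤ 1`, so scaling by `d⁻¹` brings the infimum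
    -- below `|x| ⊓ a`.
    set d : ℝ := max |c| 1
    have hd : 0 < d := lt_max_of_lt_right one_pos
    have hd1 : d⁻¹ ≤ 1 := inv_le_one_of_one_le₀ (le_max_right _ _)
    have h0 : 0 ≤ |c| • |x| ⊓ a := le_inf (smul_nonneg (abs_nonneg _) (abs_nonneg _)) ha
    have h : d⁻¹ • (|c| • |x| ⊓ a) ≤ |x| ⊓ a := by
      refine le_inf ?_ ?_
      · refine (smul_le_smul_of_nonneg_left inf_le_left (inv_nonneg.2 hd.le)).trans ?_
        rw [smul_smul]
        refine smul_le_of_le_one_left (abs_nonneg x) ?_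
        rw [inv_mul_le_iff₀ hd, mul_one]
        exact le_max_left _ _
      · exact (smul_le_of_le_one_left h0 hd1).trans inf_le_right
    have h2 := smul_le_smul_of_nonneg_left (h.trans hx) hd.le
    rwa [smul_smul, mul_inv_cancel₀ hd.ne', one_smul, smul_zero] at h2

theorem mem_disjointComplement {a : E} (ha : 0 ≤ a) {x : E} :
    x ∈ disjointComplement ha ↔ |x| ⊓ a ≤ 0 := Iff.rfl

theorem eq_zero_of_smul_mem_disjointComplement {a : E} (ha : 0 < a) {c : ℝ}
    (h : c • a ∈ disjointComplement ha.le) : c = 0 := by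
  rw [mem_disjointComplement, abs_smul_eq_abs_smul_abs, abs_of_pos ha] at h
  by_contra hc
  have hm : 0 < min |c| 1 := lt_min (abs_pos.2 hc) one_pos
  have h1 : min |c| 1 • a ≤ 0 := le_trans (le_inf
    (smul_le_smul_of_nonneg_right (min_le_left _ _) ha.le)
    (smul_le_of_le_one_left ha.le (min_le_right _ _))) h
  have h2 : min |c| 1 • a = 0 := h1.antisymm (smul_nonneg hm.le ha.le)
  exact (smul_eq_zero.1 h2).elim hm.ne' ha.ne'

/-- The coordinate is the largest `c` with `c • a ≤ x`, attained because the positive cone is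
closed. The meet of the remainder with `a` is a multiple of `a`; a positive multiple could be added
to `c`. -/
theorem IsLatticeAtom.exists_coordinate_of_nonneg {a : E} (ha : IsLatticeAtom a) {x : E}
    (hx : 0 ≤ x) : ∃ c : ℝ, 0 ≤ c ∧ c • a ≤ x ∧ x - c • a ∈ disjointComplement ha.1.le := by
  have ha0 : 0 < ‖a‖ := norm_pos_iff.2 ha.1.ne'
  set S : Set ℝ := {c | 0 ≤ c ∧ c • a ≤ x} with hS
  have hne : S.Nonempty := ⟨0, le_rfl, by simpa using hx⟩
  have hbdd : BddAbove S := ⟨‖x‖ / ‖a‖, fun c hc => by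
    rw [le_div_iff₀ ha0, ← abs_of_nonneg hc.1, ← Real.norm_eq_abs, ← norm_smul]
    exact norm_le_norm_of_abs_le_abs
      (abs_le_abs_of_nonneg (smul_nonneg hc.1 ha.1.le) hc.2)⟩
  have hcl : IsClosed S := isClosed_Ici.inter
    (isClosed_Iic.preimage (continuous_id.smul continuous_const))
  obtain ⟨h0, h1⟩ := hcl.csSup_mem hne hbdd
  refine ⟨sSup S, h0, h1, ?_⟩
  rw [mem_disjointComplement, abs_of_nonneg (sub_nonneg.2 h1)]
  obtain ⟨c, hc⟩ := ha.2 _ (le_inf (sub_nonneg.2 h1) ha.1.le) inf_le_right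
  rw [hc]
  rcases le_or_gt c 0 with hc0 | hc0
  · exact smul_nonpos_of_nonpos_of_nonneg hc0 ha.1.le
  · have h2 : c • a ≤ x - sSup S • a := hc ▸ inf_le_left
    have h3 : sSup S + c ∈ S := ⟨by positivity, by
      rw [add_smul]; exact (le_sub_iff_add_le'.1 h2)⟩
    linarith [le_csSup hbdd h3]

/-- The coordinate functional of an atom. -/
theorem IsLatticeAtom.exists_coordinate {a : E} (ha : IsLatticeAtom a) :
    ∃ φ : E →ₗ[ℝ] ℝ, ∀ x, 0 ≤ x → 0 ≤ φ x ∧ φ x • a ≤ x ∧ (x - φ x • a) ⊓ a ≤ 0 := by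
  -- Uniqueness of the coordinate also yields linearity of `φ`, since the disjoint complement is a
  -- subspace.
  have huniq : ∀ {x : E} {c d : ℝ}, x - c • a ∈ disjointComplement ha.1.le →
      x - d • a ∈ disjointComplement ha.1.le → c = d := fun {x c d} hc hd => by
    have h := Submodule.sub_mem _ hd hc
    have e : x - d • a - (x - c • a) = (c - d) • a := by module
    rw [e] at h
    exact sub_eq_zero.1 (eq_zero_of_smul_mem_disjointComplement ha.1 h)
  have hex : ∀ x : E, ∃ c : ℝ, x - c • a ∈ disjointComplement ha.1.le := fun x => by
    obtain ⟨c, -, -, hc⟩ := ha.exists_coordinate_of_nonneg (posPart_nonneg x)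
    obtain ⟨d, -, -, hd⟩ := ha.exists_coordinate_of_nonneg (negPart_nonneg x)
    refine ⟨c - d, ?_⟩
    have e : x - (c - d) • a = (x⁺ - c • a) - (x⁻ - d • a) := by
      nth_rewrite 1 [← posPart_sub_negPart x]; module
    rw [e]
    exact Submodule.sub_mem _ hc hd
  choose f hf using hex
  refine ⟨{ toFun := f, map_add' := fun x y => huniq (hf _) ?_,
            map_smul' := fun c x => huniq (hf _) ?_ }, fun x hx => ?_⟩
  · have e : x + y - (f x + f y) • a = (x - f x • a) + (y - f y • a) := by module
    rw [e]; exact Submodule.add_mem _ (hf x) (hf y)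
  · have e : c • x - (RingHom.id ℝ c • f x) • a = c • (x - f x • a) := by
      simp only [RingHom.id_apply, smul_eq_mul]; module
    rw [e]; exact Submodule.smul_mem _ _ (hf x)
  · obtain ⟨c, h0, h1, h2⟩ := ha.exists_coordinate_of_nonneg hx
    have e : f x = c := huniq (hf x) h2
    rw [mem_disjointComplement, abs_of_nonneg (sub_nonneg.2 h1)] at h2
    simp only [LinearMap.coe_mk, AddHom.coe_mk, e]
    exact ⟨h0, h1, h2⟩

theorem abs_coordinate_le {a : E} (ha : 0 < a) {φ : E →ₗ[ℝ] ℝ}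
    (hφ : ∀ x, 0 ≤ x → 0 ≤ φ x ∧ φ x • a ≤ x) (x : E) : |φ x| ≤ ‖a‖⁻¹ * ‖x‖ := by
  have ha0 : 0 < ‖a‖ := norm_pos_iff.2 ha.ne'
  have h1 : φ x ≤ φ |x| := by
    have := (hφ (|x| - x) (sub_nonneg.2 (le_abs_self x))).1
    rw [map_sub] at this; linarith
  have h2 : -φ x ≤ φ |x| := by
    have := (hφ (|x| - -x) (sub_nonneg.2 (neg_le_abs x))).1
    rw [map_sub, map_neg] at this; linarith
  refine (abs_le'.2 ⟨h1, h2⟩).trans ?_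
  obtain ⟨h3, h4⟩ := hφ |x| (abs_nonneg x)
  rw [le_inv_mul_iff₀ ha0, mul_comm, ← abs_of_nonneg h3, ← Real.norm_eq_abs, ← norm_smul,
    ← norm_abs_eq_norm x]
  exact norm_le_norm_of_abs_le_abs (abs_le_abs_of_nonneg (smul_nonneg h3 ha.le) h4)

end RealLattice

/-! ### Real vectors and positive vectors in the complexification. -/

namespace LatticeComplexification

section

variable {E : Type*} [AddCommGroup E] [Module ℝ E]

@[simp] theorem ofReal_re (x : E) : (ofReal x).re = x := rfl
@[simp] theorem ofReal_im (x : E) : (ofReal x).im = 0 := rfl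

theorem ofReal_sub (x y : E) : ofReal (x - y) = ofReal x - ofReal y := by ext <;> simp

theorem ofReal_re_add_I_smul_ofReal_im (z : LatticeComplexification E) :
    ofReal z.re + Complex.I • ofReal z.im = z := by ext <;> simp

theorem nonneg_iff [PartialOrder E] {z : LatticeComplexification E} :
    0 ≤ z ↔ 0 ≤ z.re ∧ z.im = 0 := by
  rw [le_def]; simp [eq_comm]

theorem ofReal_nonneg [PartialOrder E] {x : E} : 0 ≤ ofReal x ↔ 0 ≤ x := by
  simp [nonneg_iff]

theorem ofReal_re_of_nonneg [PartialOrder E] {z : LatticeComplexification E} (hz : 0 ≤ z) :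
    ofReal z.re = z := by
  ext <;> simp [(nonneg_iff.1 hz).2]

end

variable {E : Type*} [NormedAddCommGroup E] [Lattice E] [HasSolidNorm E] [IsOrderedAddMonoid E]
  [NormedSpace ℝ E] [IsOrderedModule ℝ E] [CompleteSpace E]

theorem norm_ofReal (x : E) : ‖ofReal x‖ = ‖x‖ := by
  rw [norm_def, modulus_ofReal, norm_abs_eq_norm]

theorem modulus_eq_re_of_nonneg {z : LatticeComplexification E} (hz : 0 ≤ z) :
    modulus z = z.re := by
  rw [← ofReal_re_of_nonneg hz, modulus_ofReal, ofReal_re, abs_of_nonneg (nonneg_iff.1 hz).1]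

theorem norm_le_norm_of_modulus_le {z : LatticeComplexification E} {x : E}
    (h : modulus z ≤ x) : ‖z‖ ≤ ‖x‖ :=
  norm_le_norm_of_abs_le_abs (abs_le_abs_of_nonneg (modulus_nonneg z) h)

end LatticeComplexification

open LatticeComplexification

/-! ### Calculus of positive operators and domination. -/

section Operators

variable {E F G : Type*}
  [NormedAddCommGroup E] [Lattice E] [HasSolidNorm E] [IsOrderedAddMonoid E]
  [NormedSpace ℝ E] [IsOrderedModule ℝ E] [CompleteSpace E]
  [NormedAddCommGroup F] [Lattice F] [HasSolidNorm F] [IsOrderedAddMonoid F]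
  [NormedSpace ℝ F] [IsOrderedModule ℝ F] [CompleteSpace F]
  [NormedAddCommGroup G] [Lattice G] [HasSolidNorm G] [IsOrderedAddMonoid G]
  [NormedSpace ℝ G] [IsOrderedModule ℝ G] [CompleteSpace G]

theorem IsPositiveOperator.im_apply_ofReal
    {T : LatticeComplexification E →L[ℂ] LatticeComplexification F} (hT : IsPositiveOperator T)
    (x : E) : (T (ofReal x)).im = 0 := by
  have h1 := (nonneg_iff.1 (hT _ (ofReal_nonneg.2 (posPart_nonneg x)))).2
  have h2 := (nonneg_iff.1 (hT _ (ofReal_nonneg.2 (negPart_nonneg x)))).2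
  rw [← posPart_sub_negPart x, ofReal_sub, map_sub, sub_im, h1, h2, sub_zero]

theorem IsPositiveOperator.re_apply
    {T : LatticeComplexification E →L[ℂ] LatticeComplexification F} (hT : IsPositiveOperator T)
    (z : LatticeComplexification E) : (T z).re = (T (ofReal z.re)).re := by
  rw [← ofReal_re_add_I_smul_ofReal_im z, map_add, map_smul]
  simp [hT.im_apply_ofReal]

theorem IsPositiveOperator.mono
    {T : LatticeComplexification E →L[ℂ] LatticeComplexification F} (hT : IsPositiveOperator T)
    {x y : E} (h : x ≤ y) : (T (ofReal x)).re ≤ (T (ofReal y)).re := by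
  have := (nonneg_iff.1 (hT _ (ofReal_nonneg.2 (sub_nonneg.2 h)))).1
  rwa [ofReal_sub, map_sub, sub_re, sub_nonneg] at this

/-- A positive operator satisfies `|T z| ≤ T |z|`. -/
theorem IsPositiveOperator.modulus_apply_le
    {T : LatticeComplexification E →L[ℂ] LatticeComplexification F} (hT : IsPositiveOperator T)
    (z : LatticeComplexification E) : modulus (T z) ≤ (T (ofReal (modulus z))).re := by
  refine modulus_le fun θ => ?_
  -- The rotated real part is the real part of `exp(-iθ) z`, and scalars commute with `T`.
  have h1 : rot (T z) θ = (T ((⟨Real.cos θ, -Real.sin θ⟩ : ℂ) • z)).re := by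
    rw [map_smul]; simp [rot]
  rw [h1, hT.re_apply]
  refine hT.mono ?_
  have h2 : ((⟨Real.cos θ, -Real.sin θ⟩ : ℂ) • z).re = rot z θ := by simp [rot]
  rw [h2]
  exact rot_le_modulus z θ

/-- The order of the complexification also demands equal imaginary parts; positivity of `T` makes
both vanish. -/
theorem operatorDominates_iff
    {T S : LatticeComplexification E →L[ℂ] LatticeComplexification F} (hT : IsPositiveOperator T) :
    OperatorDominates T S ↔ ∀ z, modulus (S z) ≤ (T (ofReal (modulus z))).re := by
  simp [OperatorDominates, le_def, hT.im_apply_ofReal]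

/-- For `z ≥ 0` one has `|z| = z`, hence `0 ≤ |S z| ≤ T z`. -/
theorem OperatorDominates.isPositiveOperator
    {T S : LatticeComplexification E →L[ℂ] LatticeComplexification F}
    (h : OperatorDominates T S) : IsPositiveOperator T := fun z hz => by
  have h1 := h z
  rw [modulus_eq_re_of_nonneg hz, ofReal_re_of_nonneg hz] at h1
  exact (ofReal_nonneg.2 (modulus_nonneg _)).trans h1

theorem OperatorDominates.modulus_apply_le
    {T S : LatticeComplexification E →L[ℂ] LatticeComplexification F}
    (h : OperatorDominates T S) (z : LatticeComplexification E) :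
    modulus (S z) ≤ (T (ofReal (modulus z))).re :=
  (operatorDominates_iff h.isPositiveOperator).1 h z

theorem IsPositiveOperator.operatorDominates_self
    {T : LatticeComplexification E →L[ℂ] LatticeComplexification F}
    (hT : IsPositiveOperator T) : OperatorDominates T T :=
  (operatorDominates_iff hT).2 hT.modulus_apply_le

theorem OperatorDominates.comp
    {T S : LatticeComplexification F →L[ℂ] LatticeComplexification G}
    {T' S' : LatticeComplexification E →L[ℂ] LatticeComplexification F}
    (h : OperatorDominates T S) (h' : OperatorDominates T' S') :
    OperatorDominates (T.comp T') (S.comp S') := by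
  have hT := h.isPositiveOperator
  have hT' := h'.isPositiveOperator
  have hTT' : IsPositiveOperator (T.comp T') := fun z hz => hT _ (hT' z hz)
  refine (operatorDominates_iff hTT').2 fun z => ?_
  refine (h.modulus_apply_le _).trans ((hT.mono (h'.modulus_apply_le z)).trans ?_)
  rw [ContinuousLinearMap.comp_apply, hT.re_apply (T' _)]

theorem OperatorDominates.one :
    OperatorDominates (1 : LatticeComplexification E →L[ℂ] LatticeComplexification E) 1 :=
  IsPositiveOperator.operatorDominates_self fun _ hz => hz

theorem OperatorDominates.pow
    {T S : LatticeComplexification E →L[ℂ] LatticeComplexification E}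
    (h : OperatorDominates T S) (n : ℕ) : OperatorDominates (T ^ n) (S ^ n) := by
  induction n with
  | zero => simpa using OperatorDominates.one
  | succ n ih => rw [pow_succ, pow_succ]; exact ih.comp h

theorem OperatorDominates.add
    {T S T' S' : LatticeComplexification E →L[ℂ] LatticeComplexification F}
    (h : OperatorDominates T S) (h' : OperatorDominates T' S') :
    OperatorDominates (T + T') (S + S') := by
  refine (operatorDominates_iff fun z hz => ?_).2 fun z => ?_
  · have h1 := nonneg_iff.1 (h.isPositiveOperator z hz)
    have h2 := nonneg_iff.1 (h'.isPositiveOperator z hz)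
    exact nonneg_iff.2 ⟨add_nonneg h1.1 h2.1, by simp [h1.2, h2.2]⟩
  · exact (modulus_add_le _ _).trans (add_le_add (h.modulus_apply_le z) (h'.modulus_apply_le z))

theorem OperatorDominates.zero :
    OperatorDominates (0 : LatticeComplexification E →L[ℂ] LatticeComplexification F) 0 :=
  IsPositiveOperator.operatorDominates_self fun _ _ => le_rfl

theorem OperatorDominates.sum {ι : Type*} (s : Finset ι)
    {T S : ι → LatticeComplexification E →L[ℂ] LatticeComplexification F}
    (h : ∀ i, OperatorDominates (T i) (S i)) :
    OperatorDominates (∑ i ∈ s, T i) (∑ i ∈ s, S i) := by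
  classical
  induction s using Finset.induction_on with
  | empty => simpa using OperatorDominates.zero
  | insert i s hi ih => rw [Finset.sum_insert hi, Finset.sum_insert hi]; exact (h i).add ih

/-- Together with powers and sums, this compares the Neumann partial sums at `z` with those at
`|z|`. -/
theorem OperatorDominates.smul
    {T S : LatticeComplexification E →L[ℂ] LatticeComplexification F}
    (h : OperatorDominates T S) (c : ℂ) : OperatorDominates ((‖c‖ : ℂ) • T) (c • S) := by
  have hre : ∀ w : LatticeComplexification F, ((‖c‖ : ℂ) • w).re = ‖c‖ • w.re := fun w => by
    rw [smul_re, Complex.ofReal_re, Complex.ofReal_im, zero_smul, sub_zero]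
  have him : ∀ w : LatticeComplexification F, ((‖c‖ : ℂ) • w).im = ‖c‖ • w.im := fun w => by
    rw [smul_im, Complex.ofReal_re, Complex.ofReal_im, zero_smul, add_zero]
  refine (operatorDominates_iff fun z hz => ?_).2 fun z => ?_
  · have h1 := nonneg_iff.1 (h.isPositiveOperator z hz)
    refine nonneg_iff.2 ⟨?_, ?_⟩
    · rw [smul_apply, hre]
      exact smul_nonneg (norm_nonneg c) h1.1
    · rw [smul_apply, him, h1.2, smul_zero]
  · rw [smul_apply, smul_apply, modulus_smul, hre]
    exact smul_le_smul_of_nonneg_left (h.modulus_apply_le z) (norm_nonneg c)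

theorem OperatorDominates.norm_le
    {T S : LatticeComplexification E →L[ℂ] LatticeComplexification F}
    (h : OperatorDominates T S) : ‖S‖ ≤ ‖T‖ := by
  refine S.opNorm_le_bound (norm_nonneg T) fun z => ?_
  refine (norm_le_norm_of_modulus_le (h.modulus_apply_le z)).trans ((norm_re_le _).trans ?_)
  refine (T.le_opNorm _).trans ?_
  rw [norm_ofReal, ← norm_def]

end Operators

/-! ### Tail operators and the measure of noncompactness. -/

section TailProjection

variable {E F : Type*}
  [NormedAddCommGroup E] [Lattice E] [HasSolidNorm E] [IsOrderedAddMonoid E]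
  [NormedSpace ℝ E] [IsOrderedModule ℝ E] [CompleteSpace E]
  [NormedAddCommGroup F] [Lattice F] [HasSolidNorm F] [IsOrderedAddMonoid F]
  [NormedSpace ℝ F] [IsOrderedModule ℝ F] [CompleteSpace F]

/-- An operator `0 ≤ Q ≤ 1` that differs from the identity by a compact operator. -/
structure IsTailOperator
    (Q : LatticeComplexification E →L[ℂ] LatticeComplexification E) : Prop where
  pos : IsPositiveOperator Q
  le_self : ∀ x : E, 0 ≤ x → (Q (ofReal x)).re ≤ x
  compact : IsCompactOperator
    (1 - Q : LatticeComplexification E →L[ℂ] LatticeComplexification E)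

theorem IsTailOperator.one :
    IsTailOperator (1 : LatticeComplexification E →L[ℂ] LatticeComplexification E) where
  pos _ hz := hz
  le_self _ _ := le_rfl
  compact := by rw [sub_self]; exact isCompactOperator_zero

/-- Closure under products is what makes the tails of a positive vector directed downwards. -/
theorem IsTailOperator.mul {P Q : LatticeComplexification E →L[ℂ] LatticeComplexification E}
    (hP : IsTailOperator P) (hQ : IsTailOperator Q) : IsTailOperator (P * Q) where
  pos z hz := hP.pos _ (hQ.pos z hz)
  le_self x hx := by
    have h := hQ.pos _ (ofReal_nonneg.2 hx)
    rw [mul_apply_eq_comp, hP.pos.re_apply]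
    exact (hP.le_self _ (nonneg_iff.1 h).1).trans (hQ.le_self x hx)
  compact := by
    have e : 1 - P * Q = (1 - P) * Q + (1 - Q) := by noncomm_ring
    rw [e]
    exact (hP.compact.comp_clm Q).add hQ.compact

theorem IsTailOperator.norm_le_one
    {Q : LatticeComplexification E →L[ℂ] LatticeComplexification E}
    (hQ : IsTailOperator Q) : ‖Q‖ ≤ 1 := by
  refine Q.opNorm_le_bound zero_le_one fun z => ?_
  rw [one_mul, norm_def z]
  exact norm_le_norm_of_modulus_le
    ((hQ.pos.modulus_apply_le z).trans (hQ.le_self _ (modulus_nonneg z)))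

/-- The tail operator `x ↦ x - φ(x) a` of an atom `a` with coordinate functional `φ`. -/
theorem IsLatticeAtom.exists_isTailOperator {a : E} (ha : IsLatticeAtom a) :
    ∃ Q : LatticeComplexification E →L[ℂ] LatticeComplexification E,
      IsTailOperator Q ∧ ∀ x : E, 0 ≤ x → (Q (ofReal x)).re ⊓ a ≤ 0 := by
  obtain ⟨φ, hφ⟩ := ha.exists_coordinate
  have hb := abs_coordinate_le ha.1 fun x hx => ⟨(hφ x hx).1, (hφ x hx).2.1⟩
  let ψ₀ : LatticeComplexification E →ₗ[ℂ] ℂ :=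
    { toFun := fun z => ⟨φ z.re, φ z.im⟩
      map_add' := fun z w => by apply Complex.ext <;> simp
      map_smul' := fun c z => by apply Complex.ext <;> simp }
  -- One summand bounds the real part, the other the imaginary part.
  let ψ : LatticeComplexification E →L[ℂ] ℂ := ψ₀.mkContinuous (‖a‖⁻¹ + ‖a‖⁻¹) fun z => by
    refine (Complex.norm_le_abs_re_add_abs_im _).trans ?_
    rw [add_mul]
    have h0 : 0 ≤ ‖a‖⁻¹ := by positivity
    exact add_le_add
      ((hb z.re).trans (mul_le_mul_of_nonneg_left (norm_re_le z) h0))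
      ((hb z.im).trans (mul_le_mul_of_nonneg_left (norm_im_le z) h0))
  have hψ : ∀ x, ψ (ofReal x) = (φ x : ℂ) := fun x => by
    change (⟨φ x, φ 0⟩ : ℂ) = _
    rw [map_zero]; rfl
  let Q : LatticeComplexification E →L[ℂ] LatticeComplexification E :=
    1 - ψ.smulRight (ofReal a)
  have hQ : ∀ x, Q (ofReal x) = ofReal (x - φ x • a) := fun x => by
    change ofReal x - ψ (ofReal x) • ofReal a = _
    rw [hψ]
    ext
    · rw [sub_re, smul_re]; simp
    · rw [sub_im, smul_im]; simp
  refine ⟨Q, ⟨fun z hz => ?_, fun x hx => ?_, ?_⟩, fun x hx => ?_⟩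
  · rw [← ofReal_re_of_nonneg hz, hQ]
    exact ofReal_nonneg.2 (sub_nonneg.2 (hφ _ (nonneg_iff.1 hz).1).2.1)
  · rw [hQ]
    exact sub_le_self _ (smul_nonneg (hφ x hx).1 ha.1.le)
  -- The operator `1 - Q` has rank one: it factors through `ℂ`.
  · rw [sub_sub_cancel]
    have h : IsCompactOperator ψ :=
      isCompactOperator_of_locallyCompactSpace_dom (ψ : LatticeComplexification E →L[ℂ] ℂ)
    exact h.clm_comp (ContinuousLinearMap.toSpanSingleton ℂ (ofReal a))
  · rw [hQ]
    exact (hφ x hx).2.2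

/-- In an atomic Banach lattice with order continuous norm the tails of a positive vector are
arbitrarily small. -/
theorem exists_isTailOperator_norm_ofReal_lt (hEa : IsAtomicBanachLattice E)
    (hEo : HasOrderContinuousNorm E) {x : E} (hx : 0 ≤ x) {ε : ℝ} (hε : 0 < ε) :
    ∃ Q : LatticeComplexification E →L[ℂ] LatticeComplexification E,
      IsTailOperator Q ∧ ‖Q (ofReal x)‖ < ε := by
  let D : Set E := {y | ∃ Q : LatticeComplexification E →L[ℂ] LatticeComplexification E,
    IsTailOperator Q ∧ y = (Q (ofReal x)).re}
  have hQx : ∀ {Q : LatticeComplexification E →L[ℂ] LatticeComplexification E},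
      IsTailOperator Q → 0 ≤ (Q (ofReal x)).re := fun hQ =>
    (nonneg_iff.1 (hQ.pos _ (ofReal_nonneg.2 hx))).1
  have hdir : DirectedOn (fun x y => y ≤ x) D := by
    rintro _ ⟨P, hP, rfl⟩ _ ⟨Q, hQ, rfl⟩
    refine ⟨_, ⟨P * Q, hP.mul hQ, rfl⟩, ?_, ?_⟩
    · change (P (Q (ofReal x))).re ≤ (P (ofReal x)).re
      rw [hP.pos.re_apply]
      exact hP.pos.mono (hQ.le_self x hx)
    · rw [mul_apply_eq_comp, hP.pos.re_apply]
      exact hP.le_self _ (hQx hQ)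
  have hglb : IsGLB D 0 := by
    refine ⟨?_, fun y hy => ?_⟩
    · rintro _ ⟨Q, hQ, rfl⟩
      exact hQx hQ
    -- Every tail of `x` lies above `y⁺`, hence above an atom `a`; but the tail operator of `a`
    -- itself yields a tail disjoint from `a`.
    · by_contra hy0
      have hpos : 0 < y⁺ := (posPart_nonneg y).lt_of_ne' fun h => hy0 (posPart_eq_zero.1 h)
      obtain ⟨a, ha, hay⟩ := hEa _ hpos
      obtain ⟨Q, hQ, hQa⟩ := ha.exists_isTailOperator
      have h1 : y⁺ ≤ (Q (ofReal x)).re := sup_le (hy ⟨Q, hQ, rfl⟩) (hQx hQ)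
      exact absurd ((le_inf (hay.trans h1) le_rfl).trans (hQa x hx)) ha.1.not_ge
  obtain ⟨_, ⟨Q, hQ, rfl⟩, h⟩ := hEo D ⟨_, 1, .one, rfl⟩ hdir hglb ε hε
  refine ⟨Q, hQ, ?_⟩
  rw [← ofReal_re_of_nonneg (hQ.pos _ (ofReal_nonneg.2 hx)), norm_ofReal]
  exact h _ ⟨Q, hQ, rfl⟩ le_rfl

/-- The sum of the moduli of the points of `C` majorizes each of them, so a tail operator that is
small on this one vector is small on all of `C`. -/
theorem exists_isTailOperator_norm_lt (hEa : IsAtomicBanachLattice E)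
    (hEo : HasOrderContinuousNorm E) {C : Set (LatticeComplexification E)} (hC : C.Finite)
    {ε : ℝ} (hε : 0 < ε) :
    ∃ Q : LatticeComplexification E →L[ℂ] LatticeComplexification E,
      IsTailOperator Q ∧ ∀ c ∈ C, ‖Q c‖ < ε := by
  obtain ⟨Q, hQ, h⟩ := exists_isTailOperator_norm_ofReal_lt hEa hEo
    (Finset.sum_nonneg fun c (_ : c ∈ hC.toFinset) => modulus_nonneg c) hε
  refine ⟨Q, hQ, fun c hc => lt_of_le_of_lt ?_ h⟩
  refine (norm_le_norm_of_modulus_le ((hQ.pos.modulus_apply_le c).trans (hQ.pos.mono ?_))).trans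
    (norm_re_le _)
  exact Finset.single_le_sum (f := fun c => modulus c) (fun c _ => modulus_nonneg c)
    (hC.mem_toFinset.2 hc)

/-- A tail operator reduces the norm of `T` to nearly the radius of a finite ball covering of the
image of the unit ball. -/
theorem exists_isTailOperator_norm_comp_le (hFa : IsAtomicBanachLattice F)
    (hFo : HasOrderContinuousNorm F)
    (T : LatticeComplexification E →L[ℂ] LatticeComplexification F)
    {C : Set (LatticeComplexification F)} (hC : C.Finite) {δ ε : ℝ} (hδ : 0 ≤ δ) (hε : 0 < ε)
    (hT : T '' Metric.closedBall 0 1 ⊆ ⋃ c ∈ C, Metric.closedBall c δ) :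
    ∃ Q : LatticeComplexification F →L[ℂ] LatticeComplexification F,
      IsTailOperator Q ∧ ‖Q.comp T‖ ≤ δ + ε := by
  obtain ⟨Q, hQ, hQC⟩ := exists_isTailOperator_norm_lt hFa hFo hC hε
  refine ⟨Q, hQ, ContinuousLinearMap.opNorm_le_of_unit_norm (by positivity) fun z hz => ?_⟩
  obtain ⟨c, hc, hTc⟩ := Set.mem_iUnion₂.1
    (hT ⟨z, mem_closedBall_zero_iff.2 hz.le, rfl⟩)
  rw [mem_closedBall_iff_norm] at hTc
  -- `Q` is a contraction on the first term and small on the centre `c`.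
  have e : Q.comp T z = Q (T z - c) + Q c := by simp
  rw [e]
  refine (norm_add_le _ _).trans (add_le_add ?_ (hQC c hc).le)
  exact ((Q.le_of_opNorm_le hQ.norm_le_one _).trans_eq (one_mul _)).trans hTc

theorem OperatorDominates.norm_comp_le
    {T S : LatticeComplexification E →L[ℂ] LatticeComplexification F}
    (h : OperatorDominates T S) {Q : LatticeComplexification F →L[ℂ] LatticeComplexification F}
    (hQ : IsTailOperator Q) : ‖Q.comp S‖ ≤ ‖Q.comp T‖ :=
  (hQ.pos.operatorDominates_self.comp h).norm_le

theorem IsCompactOperator.exists_finite_cover {X Y : Type*} [NormedAddCommGroup X]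
    [NormedSpace ℂ X] [NormedAddCommGroup Y] [NormedSpace ℂ Y] {K : X →L[ℂ] Y}
    (hK : IsCompactOperator K) {ε : ℝ} (hε : 0 < ε) :
    ∃ C : Set Y, C.Finite ∧ K '' Metric.closedBall 0 1 ⊆ ⋃ c ∈ C, Metric.closedBall c ε := by
  obtain ⟨M, hM, hKM⟩ :=
    IsCompactOperator.image_closedBall_subset_compact (f := (K : X →ₗ[ℂ] Y)) hK 1
  obtain ⟨C, hC, h⟩ := Metric.totallyBounded_iff.1 hM.totallyBounded ε hε
  exact ⟨C, hC, hKM.trans (h.trans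
    (Set.iUnion₂_mono fun c _ => Metric.ball_subset_closedBall))⟩

theorem add_image_subset_cover {X Y : Type*} [NormedAddCommGroup X]
    [NormedSpace ℂ X] [NormedAddCommGroup Y] [NormedSpace ℂ Y] {K R T : X →L[ℂ] Y}
    {C : Set Y} {δ ε : ℝ} (hT : T = R + K) (hR : ‖R‖ ≤ δ)
    (hK : K '' Metric.closedBall 0 1 ⊆ ⋃ c ∈ C, Metric.closedBall c ε) :
    T '' Metric.closedBall 0 1 ⊆ ⋃ c ∈ C, Metric.closedBall c (δ + ε) := by
  rintro _ ⟨z, hz, rfl⟩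
  obtain ⟨c, hc, hKc⟩ := Set.mem_iUnion₂.1 (hK ⟨z, hz, rfl⟩)
  refine Set.mem_iUnion₂.2 ⟨c, hc, ?_⟩
  rw [mem_closedBall_iff_norm] at hKc ⊢
  have e : T z - c = R z + (K z - c) := by rw [hT, add_apply]; abel
  rw [e]
  refine (norm_add_le _ _).trans (add_le_add ?_ hKc)
  exact (R.unit_le_opNorm z (mem_closedBall_zero_iff.1 hz)).trans hR

/-- Passing from `S` to `Q S` costs only the compact operator `(1 - Q) S`. -/
theorem IsTailOperator.isCompactOperator_sub_comp
    {Q : LatticeComplexification F →L[ℂ] LatticeComplexification F} (hQ : IsTailOperator Q)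
    (S : LatticeComplexification E →L[ℂ] LatticeComplexification F) :
    IsCompactOperator (S - Q.comp S) := by
  have e : S - Q.comp S = (1 - Q).comp S := by ext1 z; simp
  rw [e]
  exact hQ.compact.comp_clm S

/-- Domination decreases the measure of noncompactness. -/
theorem OperatorDominates.operatorNoncompactness_le (hFa : IsAtomicBanachLattice F)
    (hFo : HasOrderContinuousNorm F)
    {T S : LatticeComplexification E →L[ℂ] LatticeComplexification F}
    (h : OperatorDominates T S) : operatorNoncompactness S ≤ operatorNoncompactness T := by
  -- The set of radii must be shown nonempty; the summand `1` keeps the radius positive even for `T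
  -- = 0`.
  refine le_csInf ⟨‖T‖ + 1, by positivity, {0}, Set.finite_singleton 0, ?_⟩ ?_
  · exact add_image_subset_cover (K := 0) (add_zero T).symm le_rfl
      (by rintro _ ⟨z, -, rfl⟩; simp)
  · rintro δ ⟨hδ, C, hC, hT⟩
    refine le_of_forall_pos_le_add fun ε hε => ?_
    obtain ⟨Q, hQ, hQT⟩ :=
      exists_isTailOperator_norm_comp_le hFa hFo T hC hδ.le (half_pos hε) hT
    obtain ⟨C', hC', hS⟩ := (hQ.isCompactOperator_sub_comp S).exists_finite_cover (half_pos hε)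
    refine csInf_le ⟨0, fun _ hx => hx.1.le⟩ ⟨by positivity, C', hC', ?_⟩
    have := add_image_subset_cover (add_sub_cancel (Q.comp S) S).symm
      ((h.norm_comp_le hQ).trans hQT) hS
    rwa [add_assoc, add_halves] at this

end TailProjection

/-! ### Spectral radius and resolvent growth in a Banach algebra. -/

section BanachAlgebra

open Filter Topology

variable {A : Type*} [NormedRing A] [NormedAlgebra ℂ A] [CompleteSpace A]

/-- The Neumann series represents `(1 - z a)⁻¹` for `|z|` below the inverse of the spectral
radius. -/
theorem hasSum_smul_pow_inverse_one_sub_smul (a : A) {z : ℂ}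
    (hz : (‖z‖₊ : ℝ≥0∞) < (spectralRadius ℂ a)⁻¹) :
    HasSum (fun n => (z • a) ^ n) (Ring.inverse (1 - z • a)) := by
  obtain ⟨r, hzr, hr⟩ := ENNReal.lt_iff_exists_nnreal_btwn.1 hz
  have hr0 : 0 < r := zero_le.trans_lt (ENNReal.coe_lt_coe.1 hzr)
  -- The inverse is holomorphic up to radius `r`, so it has a power series there; uniqueness of
  -- power series identifies it with the Neumann series, known near `0`.
  have h1 := (spectrum.differentiableOn_inverse_one_sub_smul hr).hasFPowerSeriesOnBall hr0
  have h2 := (spectrum.hasFPowerSeriesOnBall_inverse_one_sub_smul ℂ a).exchange_radius h1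
  have h3 := h2.hasSum (y := z) (by
    simpa [edist_zero_right, enorm_eq_nnnorm, ← NNReal.coe_lt_coe] using hzr)
  simpa [smul_pow] using h3

/-- The ball of radius `‖v⁻¹‖⁻¹` about a unit `v` consists of units. Bounded inverses keep this
radius away from `0`, so the limit lies in one of these balls. -/
theorem isUnit_of_tendsto_of_norm_inverse_le {ι : Type*} {l : Filter ι} [l.NeBot] {u : ι → A}
    {b : A} (hu : Tendsto u l (𝓝 b)) {M : ℝ} (h : ∀ᶠ i in l, IsUnit (u i) ∧
      ‖Ring.inverse (u i)‖ ≤ M) : IsUnit b := by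
  have hM : 0 < max M 1 := lt_max_of_lt_right one_pos
  have h1 : ∀ᶠ i in l, dist (u i) b < (max M 1)⁻¹ := Metric.tendsto_nhds.1 hu _ (inv_pos.2 hM)
  obtain ⟨i, ⟨⟨v, hv⟩, hi⟩, hd⟩ := (h.and h1).exists
  rcases subsingleton_or_nontrivial A with hA | hA
  · exact isUnit_of_subsingleton b
  · rw [← hv, Ring.inverse_unit] at hi
    rw [← hv, dist_comm, dist_eq_norm] at hd
    refine ⟨v.ofNearby b (hd.trans_le ?_), rfl⟩
    exact inv_anti₀ (Units.norm_pos _) (hi.trans (le_max_left _ _))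

/-- If the partial sums of the Neumann series of `a` at `z` are bounded in norm by those at `|z|`,
then the spectral radius of `a` belongs to the spectrum. -/
theorem spectralRadius_mem_spectrum_of_norm_sum_le [Nontrivial A] (a : A)
    (h : ∀ (z : ℂ) (n : ℕ), ‖∑ i ∈ Finset.range n, (z • a) ^ i‖
      ≤ ‖∑ i ∈ Finset.range n, ((‖z‖ : ℂ) • a) ^ i‖) :
    ((spectralRadius ℂ a).toReal : ℂ) ∈ spectrum ℂ a := by
  obtain ⟨μ, hμ, hμr⟩ := spectrum.exists_nnnorm_eq_spectralRadius a
  have hr : (spectralRadius ℂ a).toReal = ‖μ‖ := by rw [← hμr]; simp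
  rw [hr]
  rcases eq_or_ne μ 0 with rfl | hμ0
  · simpa using hμ
  have hμn : 0 < ‖μ‖ := norm_pos_iff.2 hμ0
  -- The bound on partial sums passes to the limit of the Neumann series.
  have hle : ∀ z : ℂ, (‖z‖₊ : ℝ≥0∞) < (spectralRadius ℂ a)⁻¹ →
      ‖Ring.inverse (1 - z • a)‖ ≤ ‖Ring.inverse (1 - (‖z‖ : ℂ) • a)‖ := fun z hz =>
    le_of_tendsto_of_tendsto' (hasSum_smul_pow_inverse_one_sub_smul a hz).tendsto_sum_nat.norm
      (hasSum_smul_pow_inverse_one_sub_smul a (z := (‖z‖ : ℂ))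
        (by simpa using hz)).tendsto_sum_nat.norm (h z)
  have hunit : ∀ {ν : ℂ}, ν ≠ 0 → (IsUnit (1 - ν⁻¹ • a) ↔ ν ∉ spectrum ℂ a) := fun {ν} hν => by
    rw [spectrum.notMem_iff]
    have e : algebraMap ℂ A ν - a = (Units.mk0 ν hν) • (1 - ν⁻¹ • a) := by
      rw [Units.smul_def, Units.val_mk0, smul_sub, smul_smul, mul_inv_cancel₀ hν, one_smul,
        Algebra.algebraMap_eq_smul_one]
    rw [e, isUnit_smul_iff]
  by_contra hmem
  -- If `‖μ‖` were not spectral, the inverses would stay bounded as `t ↑ 1` along `t * ‖μ‖⁻¹`, hence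
  -- along `t * μ⁻¹`, making `1 - μ⁻¹ • a` invertible.
  have hu : IsUnit (1 - ((‖μ‖ : ℂ))⁻¹ • a) :=
    (hunit (Complex.ofReal_ne_zero.2 hμn.ne')).2 hmem
  have hcont : ∀ c : ℂ, Tendsto (fun t : ℝ => 1 - ((t : ℂ) * c) • a)
      (𝓝[<] (1 : ℝ))
      (𝓝 (1 - c • a)) := fun c => by
    have hc : Continuous fun t : ℝ => 1 - ((t : ℂ) * c) • a := by fun_prop
    have h1 := hc.tendsto (1 : ℝ)
    simp only [Complex.ofReal_one, one_mul] at h1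
    exact h1.mono_left nhdsWithin_le_nhds
  obtain ⟨v, hv⟩ := hu
  have hb : ∀ᶠ t : ℝ in 𝓝[<] 1, ‖Ring.inverse (1 - ((t : ℂ) * (‖μ‖ : ℂ)⁻¹) • a)‖
      < ‖Ring.inverse (v : A)‖ + 1 := by
    have h1 := hcont (‖μ‖ : ℂ)⁻¹
    rw [← hv] at h1
    exact ((NormedRing.inverse_continuousAt v).tendsto.comp h1).norm.eventually_lt_const
      (lt_add_one _)
  refine (hunit hμ0).1 (isUnit_of_tendsto_of_norm_inverse_le (hcont μ⁻¹)
    (M := ‖Ring.inverse (v : A)‖ + 1) ?_) hμ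
  filter_upwards [hb, Ioo_mem_nhdsLT (zero_lt_one (α := ℝ))] with t ht ht01
  have hnorm : ‖(t : ℂ) * μ⁻¹‖ = t * ‖μ‖⁻¹ := by
    rw [norm_mul, norm_inv, Complex.norm_real, Real.norm_of_nonneg ht01.1.le]
  have hlt : (‖(t : ℂ) * μ⁻¹‖₊ : ℝ≥0∞) < (spectralRadius ℂ a)⁻¹ := by
    rw [← hμr, ← ENNReal.coe_inv (nnnorm_ne_zero_iff.2 hμ0), ENNReal.coe_lt_coe,
      ← NNReal.coe_lt_coe]
    simp only [coe_nnnorm, NNReal.coe_inv]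
    rw [hnorm]
    exact mul_lt_of_lt_one_left (inv_pos.2 hμn) ht01.2
  refine ⟨spectrum.isUnit_one_sub_smul_of_lt_inv_radius hlt, (hle _ hlt).trans ?_⟩
  rw [hnorm]
  simpa using ht.le

/-- Gelfand's formula. -/
theorem spectralRadius_le_of_norm_pow_le {a b : A} (h : ∀ n : ℕ, ‖a ^ n‖ ≤ ‖b ^ n‖) :
    spectralRadius ℂ a ≤ spectralRadius ℂ b :=
  le_of_tendsto_of_tendsto' (spectrum.pow_nnnorm_pow_one_div_tendsto_nhds_spectralRadius a)
    (spectrum.pow_nnnorm_pow_one_div_tendsto_nhds_spectralRadius b) fun n =>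
      ENNReal.rpow_le_rpow (ENNReal.coe_le_coe.2 (h n)) (by positivity)

end BanachAlgebra

/-! ### Quotients of normed algebras by closed two-sided ideals. -/

section Quotient

variable {R : Type*} [NormedRing R] (I : Ideal R)

theorem Ideal.Quotient.exists_mk_eq_norm_lt [I.IsTwoSided] (x : R ⧸ I) {ε : ℝ} (hε : 0 < ε) :
    ∃ r : R, Ideal.Quotient.mk I r = x ∧ ‖r‖ < ‖x‖ + ε :=
  Submodule.Quotient.norm_mk_lt x hε

/-- The quotient of a normed ring by a closed two-sided ideal. -/
noncomputable abbrev Ideal.Quotient.normedRingOfIsTwoSided [I.IsTwoSided]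
    [IsClosed (I : Set R)] : NormedRing (R ⧸ I) where
  __ := Submodule.Quotient.normedAddCommGroup I
  __ := Ideal.Quotient.ring I
  norm_mul_le x y := by
    -- Products of nearly optimal lifts of `x` and `y` lift `x * y`; the errors `1 / (n + 1)` vanish
    -- in the limit.
    have hpos : ∀ n : ℕ, (0 : ℝ) < 1 / ((n : ℝ) + 1) := fun n => by positivity
    choose a ha ha' using fun n : ℕ => Ideal.Quotient.exists_mk_eq_norm_lt I x (hpos n)
    choose b hb hb' using fun n : ℕ => Ideal.Quotient.exists_mk_eq_norm_lt I y (hpos n)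
    have hx : Filter.Tendsto (fun n : ℕ => ‖x‖ + 1 / ((n : ℝ) + 1)) Filter.atTop
        (nhds (‖x‖ + 0)) := tendsto_one_div_add_atTop_nhds_zero_nat.const_add _
    have hy : Filter.Tendsto (fun n : ℕ => ‖y‖ + 1 / ((n : ℝ) + 1)) Filter.atTop
        (nhds (‖y‖ + 0)) := tendsto_one_div_add_atTop_nhds_zero_nat.const_add _
    have hxy := hx.mul hy
    rw [add_zero, add_zero] at hxy
    refine ge_of_tendsto' hxy fun n => ?_
    have e : x * y = Ideal.Quotient.mk I (a n * b n) := by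
      rw [map_mul, ha, hb]
    rw [e]
    refine (Submodule.Quotient.norm_mk_le I (a n * b n)).trans ((norm_mul_le _ _).trans ?_)
    exact mul_le_mul (ha' n).le (hb' n).le (norm_nonneg _) ((norm_nonneg _).trans (ha' n).le)

/-- The quotient of a normed algebra by a closed two-sided ideal. -/
noncomputable abbrev Ideal.Quotient.normedAlgebraOfIsTwoSided [I.IsTwoSided]
    [IsClosed (I : Set R)] (𝕜 : Type*) [NormedField 𝕜] [NormedAlgebra 𝕜 R] :
    letI := Ideal.Quotient.normedRingOfIsTwoSided I
    NormedAlgebra 𝕜 (R ⧸ I) :=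
  letI := Ideal.Quotient.normedRingOfIsTwoSided I
  { Ideal.Quotient.algebra 𝕜 with
    norm_smul_le := (Submodule.Quotient.normedSpace I 𝕜).norm_smul_le }

end Quotient

/-! ### The Calkin algebra as a Banach algebra and the essential norm. -/

section Calkin

variable {X : Type*} [NormedAddCommGroup X] [NormedSpace ℂ X] [CompleteSpace X]

instance isClosed_compactIdeal : IsClosed (compactIdeal X : Set (X →L[ℂ] X)) :=
  isClosed_setOfPred_isCompactOperator

noncomputable instance : NormedRing (CalkinAlgebra X) :=
  Ideal.Quotient.normedRingOfIsTwoSided (compactIdeal X)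

noncomputable instance : NormedAlgebra ℂ (CalkinAlgebra X) :=
  Ideal.Quotient.normedAlgebraOfIsTwoSided (compactIdeal X) ℂ

instance : CompleteSpace (CalkinAlgebra X) :=
  Submodule.Quotient.completeSpace (compactIdeal X)

/-- The essential norm of `T`: the norm of its image in the Calkin algebra. -/
noncomputable def essentialNorm (T : X →L[ℂ] X) : ℝ :=
  ‖(Ideal.Quotient.mk (compactIdeal X) T : CalkinAlgebra X)‖

theorem essentialNorm_nonneg (T : X →L[ℂ] X) : 0 ≤ essentialNorm T := norm_nonneg _

theorem essentialNorm_le_of_isCompactOperator_sub {S R : X →L[ℂ] X}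
    (h : IsCompactOperator (S - R)) : essentialNorm S ≤ ‖R‖ := by
  have e : (Ideal.Quotient.mk (compactIdeal X) S : CalkinAlgebra X) = Ideal.Quotient.mk _ R :=
    Ideal.Quotient.eq.2 h
  rw [essentialNorm, e]
  exact Submodule.Quotient.norm_mk_le (compactIdeal X) R

theorem exists_isCompactOperator_sub_norm_lt (T : X →L[ℂ] X) {ε : ℝ} (hε : 0 < ε) :
    ∃ R : X →L[ℂ] X, IsCompactOperator (T - R) ∧ ‖R‖ < essentialNorm T + ε := by
  obtain ⟨R, hR, h⟩ := Ideal.Quotient.exists_mk_eq_norm_lt (compactIdeal X)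
    (Ideal.Quotient.mk (compactIdeal X) T) hε
  exact ⟨R, Ideal.Quotient.eq.1 hR.symm, h⟩

/-- Otherwise the identity would be compact, which by Riesz forces finite dimension. Nontriviality
is needed for the spectrum to be nonempty. -/
theorem nontrivial_calkinAlgebra (h : ¬ FiniteDimensional ℂ X) :
    Nontrivial (CalkinAlgebra X) := by
  refine Ideal.Quotient.nontrivial_iff.2 fun htop => h ?_
  have h1 : (1 : X →L[ℂ] X) ∈ compactIdeal X := htop ▸ Submodule.mem_top
  exact FiniteDimensional.of_isCompactOperator_id h1

theorem essentialSpectralRadius_mem_of_essentialNorm_sum_le (hX : ¬ FiniteDimensional ℂ X)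
    (T : X →L[ℂ] X)
    (h : ∀ (z : ℂ) (n : ℕ), essentialNorm (∑ i ∈ Finset.range n, (z • T) ^ i)
      ≤ essentialNorm (∑ i ∈ Finset.range n, ((‖z‖ : ℂ) • T) ^ i)) :
    ((essentialSpectralRadius T).toReal : ℂ) ∈ essentialSpectrum T := by
  have := nontrivial_calkinAlgebra hX
  have hmk : ∀ (z : ℂ) (n : ℕ), Ideal.Quotient.mk (compactIdeal X)
      (∑ i ∈ Finset.range n, (z • T) ^ i)
      = ∑ i ∈ Finset.range n,
        (z • (Ideal.Quotient.mk (compactIdeal X) T : CalkinAlgebra X)) ^ i := fun z n => by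
    rw [map_sum]
    refine Finset.sum_congr rfl fun i _ => ?_
    rw [map_pow]
    rfl
  refine spectralRadius_mem_spectrum_of_norm_sum_le _ fun z n => ?_
  rw [← hmk, ← hmk]
  exact h z n

theorem essentialSpectralRadius_le_of_essentialNorm_pow_le {S T : X →L[ℂ] X}
    (h : ∀ n : ℕ, essentialNorm (S ^ n) ≤ essentialNorm (T ^ n)) :
    essentialSpectralRadius S ≤ essentialSpectralRadius T := by
  refine spectralRadius_le_of_norm_pow_le fun n => ?_
  rw [← map_pow, ← map_pow]
  exact h n

end Calkin

/-! ### Monotonicity of the essential norm and the theorem. -/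

section

variable {E : Type*} [NormedAddCommGroup E] [Lattice E] [HasSolidNorm E] [IsOrderedAddMonoid E]
  [NormedSpace ℝ E] [IsOrderedModule ℝ E] [CompleteSpace E]

/-- Domination decreases the essential norm. -/
theorem OperatorDominates.essentialNorm_le (hEa : IsAtomicBanachLattice E)
    (hEo : HasOrderContinuousNorm E)
    {T S : LatticeComplexification E →L[ℂ] LatticeComplexification E}
    (h : OperatorDominates T S) : essentialNorm S ≤ essentialNorm T := by
  refine le_of_forall_pos_le_add fun ε hε => ?_
  have hε3 : 0 < ε / 3 := by positivity
  -- Three errors of `ε / 3`: a nearly optimal `R` congruent to `T` modulo compacts, a finite cover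
  -- for the compact `T - R`, and the tail operator on its centres.
  obtain ⟨R, hR, hRT⟩ := exists_isCompactOperator_sub_norm_lt T hε3
  obtain ⟨C, hC, hcov⟩ := hR.exists_finite_cover hε3
  have hδ : 0 ≤ essentialNorm T + ε / 3 + ε / 3 := by
    have := essentialNorm_nonneg T
    positivity
  obtain ⟨Q, hQ, hQT⟩ := exists_isTailOperator_norm_comp_le hEa hEo T hC hδ hε3
    (add_image_subset_cover (add_sub_cancel R T).symm hRT.le hcov)
  refine (essentialNorm_le_of_isCompactOperator_sub (hQ.isCompactOperator_sub_comp S)).trans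
    ((h.norm_comp_le hQ).trans (hQT.trans_eq ?_))
  ring

end

theorem mainTheorem6
    {E : Type*} [NormedAddCommGroup E] [Lattice E] [HasSolidNorm E] [IsOrderedAddMonoid E]
    [NormedSpace ℝ E] [IsOrderedModule ℝ E] [CompleteSpace E]
    {F : Type*} [NormedAddCommGroup F] [Lattice F] [HasSolidNorm F] [IsOrderedAddMonoid F]
    [NormedSpace ℝ F] [IsOrderedModule ℝ F] [CompleteSpace F]
    (hEa : IsAtomicBanachLattice E) (hEo : HasOrderContinuousNorm E)
    (hFa : IsAtomicBanachLattice F) (hFo : HasOrderContinuousNorm F) :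
    (¬ FiniteDimensional ℂ (LatticeComplexification E) →
      ∀ T : LatticeComplexification E →L[ℂ] LatticeComplexification E, IsPositiveOperator T →
        ((essentialSpectralRadius T).toReal : ℂ) ∈ essentialSpectrum T) ∧
    (∀ S T : LatticeComplexification E →L[ℂ] LatticeComplexification E, OperatorDominates T S →
      essentialSpectralRadius S ≤ essentialSpectralRadius T) ∧
    (∀ S T : LatticeComplexification E →L[ℂ] LatticeComplexification F, OperatorDominates T S →
      operatorNoncompactness S ≤ operatorNoncompactness T) := by
  refine ⟨fun hE T hT => ?_, fun S T h => ?_, fun S T h => h.operatorNoncompactness_le hFa hFo⟩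
  -- A positive `T` dominates itself, so `|z| T` dominates `z T`, and the partial sums inherit this.
  · exact essentialSpectralRadius_mem_of_essentialNorm_sum_le hE T fun z n =>
      (OperatorDominates.sum _ fun i =>
        (hT.operatorDominates_self.smul z).pow i).essentialNorm_le hEa hEo
  · exact essentialSpectralRadius_le_of_essentialNorm_pow_le fun n =>
      (h.pow n).essentialNorm_le hEa hEo
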